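/- An ordered space is a real vector space $E$ with a cone $E_+$ (closed under sums and multiplication by non-negative scalars, with $E_+\cap(-E_+)=\{0\}$), ordered by $x\ge y\iff x-y\in E_+$. Let $E$ be an ordered space with a locally convex topology generated by a family $\{p_\alpha\}_{\alpha\in A}$ of seminorms which separates points ($p_\alpha(x)=0$ for all $\alpha\in A$ implies $x=0$), and assume that the family is saturated: the pointwise maximum of any non-empty finite subfamily again belongs to the family. Then the following are equivalent. (1) The cone $E_+$ is closed, and every $p_\alpha$ is increasing, that is, $0\le y\le x$ implies $p_\alpha(y)\le p_\alpha(x)$. (2) There exist a locally compact Hausdorff space $X$, a linear subspace $W$ of $C(X)$ (the space of continuous real-valued functions on $X$, with the compact-open topology and the cone of pointwise non-negative functions; $W$ carries the induced topology and order), a linear bijection $\phi\colon E\to W$, and a family $\{K_\alpha\}_{\alpha\in A}$ of pairwise disjoint compact subsets of $X$ such that: - $\phi$ is bipositive, that is, $x\in E_+\iff\phi(x)\ge 0$, and both $\phi$ and $\phi^{-1}$ are continuous; - the topology of $C(X)$ is generated by the seminorms $|g|_{K_\alpha}:=\sup_{t\in K_\alpha}|g(t)|$, $\alpha\in A$; -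 $X=\bigcup_{\alpha\in A}K_\alpha$, and every compact subset of $X$ is contained in a union of finitely many of the sets $K_\alpha$; - $|\phi(x)|_{K_\alpha}=p_\alpha(x)$ for all $x\in E_+$ and all $\alpha\in A$. -/

import Mathlib

noncomputable section

open TopologicalSpace

/-- The seminorm `f ↦ sup_{x ∈ K} |f x|` on `C(X, ℝ)`, for a compact set `K ⊆ X`
(with value `0` if `K` is empty). -/
def supSeminorm {X : Type*} [TopologicalSpace X] (K : Compacts X) : Seminorm ℝ C(X, ℝ) :=
  have bdd : ∀ f : C(X, ℝ), BddAbove (Set.range fun x : K => |f x|) := fun f => by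
    have h := K.isCompact.bddAbove_image (f := fun x => |f x|) (by fun_prop)
    rwa [Set.image_eq_range] at h
  Seminorm.of (fun f => ⨆ x : K, |f x|)
    (fun f g => by
      refine Real.iSup_le (fun x => ?_)
        (add_nonneg (Real.iSup_nonneg fun _ => abs_nonneg _)
          (Real.iSup_nonneg fun _ => abs_nonneg _))
      exact (abs_add_le (f x) (g x)).trans (add_le_add (le_ciSup (bdd f) x) (le_ciSup (bdd g) x)))
    (fun a f => by
      simp only [ContinuousMap.smul_apply, smul_eq_mul, abs_mul, Real.norm_eq_abs]
      exact (Real.mul_iSup_of_nonneg (abs_nonneg a) _).symm)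

/-- A seminorm on an ordered space is increasing if `0 ≤ y ≤ x` implies `p y ≤ p x`. -/
def Seminorm.IsIncreasing {E : Type*} [AddCommGroup E] [Module ℝ E] [PartialOrder E]
    (p : Seminorm ℝ E) : Prop :=
  ∀ ⦃x y : E⦄, 0 ≤ y → y ≤ x → p y ≤ p x

/-- A family of seminorms is saturated if the pointwise maximum of any nonempty finite subfamily
belongs to the family. -/
def IsSaturatedFamily {E A : Type*} [AddCommGroup E] [Module ℝ E] (p : A → Seminorm ℝ E) : Prop :=
  ∀ (s : Finset A) (hs : s.Nonempty), ∃ β : A, ∀ x : E, p β x = s.sup' hs fun α => p α x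

/-- A calibration of a real vector space with a topology: a family of seminorms that generates
the topology and separates the points. -/
structure IsCalibration {E A : Type*} [AddCommGroup E] [Module ℝ E] [TopologicalSpace E]
    (p : A → Seminorm ℝ E) : Prop where
  withSeminorms : WithSeminorms p
  separating : ∀ x : E, (∀ α, p α x = 0) → x = 0

end

universe u v w

open TopologicalSpace Topology Filter

/-! ### The compact-open topology and sup seminorms. -/

section SupSeminorm

variable {X : Type*} [TopologicalSpace X]

/-! For (1) ⇒ (2), let `q_α(x) = inf_{y ≥ 0} p_α(x + y)` and let `K_α` be the pointwise compact set
of linear functionals below `q_α`. Take `X` to be the disjoint union of the `K_α` and `φ` to be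
evaluation. By Hahn–Banach the sublinear `q_α` is the maximum of the functionals in `K_α`, so
everything reduces to `q_α`. Monotonicity gives `q_α = p_α` on the cone and `p_α(x) ≤ q_α(x) + 2
q_α(-x)`, hence `|φ(x)|_{K_α} ≤ p_α(x) ≤ 3 |φ(x)|_{K_α}`: `φ` is a homeomorphism onto its image. If
`φ(x) ≥ 0`, then every `q_α(-x)` vanishes, and saturation puts `x` in the closure of the cone. The
converse holds because order and sup seminorms in `C(X)` are pointwise. -/

theorem abs_le_supSeminorm (K : Compacts X) (f : C(X, ℝ)) {x : X} (hx : x ∈ K) :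
    |f x| ≤ supSeminorm K f := by
  have h := K.isCompact.bddAbove_image (f := fun x => |f x|) (by fun_prop)
  rw [Set.image_eq_range] at h
  exact le_ciSup h (⟨x, hx⟩ : K)

theorem supSeminorm_le {K : Compacts X} {f : C(X, ℝ)} {c : ℝ} (hc : 0 ≤ c)
    (h : ∀ x ∈ K, |f x| ≤ c) : supSeminorm K f ≤ c :=
  Real.iSup_le (fun x => h x x.2) hc

/-- If every compact set is covered by finitely many of the sets `K i`, then the compact-open
topology is generated by the seminorms `supSeminorm (K i)`. -/
theorem withSeminorms_supSeminorm {ι : Type*} (K : ι → Compacts X)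
    (hK : ∀ L : Set X, IsCompact L → ∃ s : Finset ι, L ⊆ ⋃ i ∈ s, (K i : Set X)) :
    WithSeminorms (fun i => supSeminorm (K i)) := by
  rw [SeminormFamily.withSeminorms_iff_nhds_eq_iInf]
  have hb : (𝓝 (0 : C(X, ℝ))).HasBasis (fun Ki : Set X × ℝ ↦ IsCompact Ki.1 ∧ 0 < Ki.2)
      fun Ki ↦ {f : C(X, ℝ) | Set.MapsTo f Ki.1 (Metric.ball 0 Ki.2)} :=
    (Metric.nhds_basis_ball (x := (0 : ℝ))).nhds_continuousMapConst
  refine le_antisymm (le_iInf fun i => ?_) ?_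
  · rw [← tendsto_iff_comap, hb.tendsto_iff Metric.nhds_basis_closedBall]
    refine fun ε hε => ⟨(K i, ε), ⟨(K i).isCompact, hε⟩, fun f hf => ?_⟩
    rw [mem_closedBall_zero_iff, Real.norm_of_nonneg (apply_nonneg _ _)]
    exact supSeminorm_le hε.le fun x hx => (mem_ball_zero_iff.1 (hf hx)).le
  · refine hb.ge_iff.2 fun ⟨L, ε⟩ ⟨hL, hε⟩ => ?_
    obtain ⟨s, hs⟩ := hK L hL
    have hmem : (⋂ i ∈ s, {f : C(X, ℝ) | supSeminorm (K i) f < ε}) ∈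
        ⨅ i, comap (supSeminorm (K i)) (𝓝 0) := by
      refine (Filter.biInter_finset_mem s).2 fun i _ => mem_iInf_of_mem i ?_
      exact preimage_mem_comap (Iio_mem_nhds hε)
    refine mem_of_superset hmem fun f hf x hx => ?_
    obtain ⟨i, hi, hxi⟩ := Set.mem_iUnion₂.1 (hs hx)
    exact mem_ball_zero_iff.2
      ((abs_le_supSeminorm (K i) f hxi).trans_lt (Set.mem_iInter₂.1 hf i hi))

end SupSeminorm

/-- A sublinear functional is the pointwise maximum of the linear functionals it dominates. -/
theorem exists_linearMap_le_sublinear_eq {E : Type*} [AddCommGroup E] [Module ℝ E] (N : E → ℝ)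
    (N_hom : ∀ c : ℝ, 0 < c → ∀ x, N (c • x) = c * N x) (N_add : ∀ x y, N (x + y) ≤ N x + N y)
    (x : E) : ∃ g : E →ₗ[ℝ] ℝ, g x = N x ∧ ∀ y, g y ≤ N y := by
  have N_zero : N 0 = 0 := by
    have := N_hom 2 two_pos 0
    rw [smul_zero] at this
    linarith
  have H : ∀ c : ℝ, c • x = 0 → (RingHom.id ℝ) c • N x = 0 := by
    intro c hc
    rcases smul_eq_zero.1 hc with rfl | rfl <;> simp [N_zero]
  obtain ⟨g, hg, hgN⟩ := exists_extension_of_le_sublinear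
    (LinearPMap.mkSpanSingleton' x (N x) H) N N_hom N_add (by
      rintro ⟨y, hy⟩
      obtain ⟨c, rfl⟩ := Submodule.mem_span_singleton.1 hy
      rw [LinearPMap.mkSpanSingleton'_apply]
      simp only [RingHom.id_apply, smul_eq_mul]
      rcases lt_trichotomy c 0 with hc | rfl | hc
      -- For negative `c`, `0 = N 0 ≤ N (c • x) + (-c) * N x` is the required bound.
      · have h := N_add (c • x) ((-c) • x)
        rw [N_hom (-c) (neg_pos.2 hc), ← add_smul, add_neg_cancel, zero_smul, N_zero] at h
        linarith
      · simp [N_zero]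
      · exact (N_hom c hc x).ge)
  refine ⟨g, ?_, hgN⟩
  have hx : x ∈ (LinearPMap.mkSpanSingleton' x (N x) H).domain := Submodule.mem_span_singleton_self x
  exact (hg ⟨x, hx⟩).trans (LinearPMap.mkSpanSingleton'_apply_self x (N x) H hx)

/-! ### The sublinear functional `distNonpos` and its dual ball. -/

namespace Seminorm

variable {E : Type*} [AddCommGroup E] [Module ℝ E] [PartialOrder E]

/-- The distance, with respect to the seminorm `p`, from a point to the cone of nonpositive
elements. -/
noncomputable def distNonpos (p : Seminorm ℝ E) (x : E) : ℝ :=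
  ⨅ y : {y : E // 0 ≤ y}, p (x + y)

/-- The linear functionals dominated by `p.distNonpos`, i.e. the positive linear functionals
dominated by `p`, as a subset of `E → ℝ`. -/
def posDualBall (p : Seminorm ℝ E) : Set (E → ℝ) :=
  {f | (∀ x y, f (x + y) = f x + f y) ∧ (∀ (c : ℝ) x, f (c • x) = c * f x) ∧
    ∀ x, f x ≤ p.distNonpos x}

variable (p : Seminorm ℝ E)

theorem distNonpos_le_add (x : E) {y : E} (hy : 0 ≤ y) : p.distNonpos x ≤ p (x + y) :=
  ciInf_le ⟨0, by rintro _ ⟨y, rfl⟩; exact apply_nonneg p _⟩ (⟨y, hy⟩ : {y : E // 0 ≤ y})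

theorem distNonpos_le (x : E) : p.distNonpos x ≤ p x := by
  simpa using p.distNonpos_le_add x le_rfl

theorem distNonpos_nonneg (x : E) : 0 ≤ p.distNonpos x :=
  Real.iInf_nonneg fun _ => apply_nonneg p _

theorem exists_add_lt_of_distNonpos_lt {x : E} {r : ℝ} (h : p.distNonpos x < r) :
    ∃ y, 0 ≤ y ∧ p (x + y) < r := by
  have : Nonempty {y : E // 0 ≤ y} := ⟨⟨0, le_rfl⟩⟩
  obtain ⟨y, hy⟩ := exists_lt_of_ciInf_lt h
  exact ⟨y, y.2, hy⟩

/-- Tychonoff: the set is cut out of a product of intervals by closed pointwise conditions. -/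
theorem isCompact_posDualBall : IsCompact p.posDualBall := by
  have hsub : p.posDualBall ⊆
      Set.univ.pi fun x => Set.Icc (-p.distNonpos (-x)) (p.distNonpos x) := by
    rintro f ⟨-, hsmul, hle⟩ x -
    have h := hle (-x)
    rw [← neg_one_smul ℝ x, hsmul, neg_one_smul] at h
    exact ⟨by linarith, hle x⟩
  refine (isCompact_univ_pi fun x => isCompact_Icc).of_isClosed_subset ?_ hsub
  simp only [posDualBall, Set.ofPred_and, Set.ofPred_forall]
  refine IsClosed.inter ?_ (IsClosed.inter ?_ ?_)
  · exact isClosed_iInter fun x => isClosed_iInter fun y =>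
      isClosed_eq (continuous_apply _) ((continuous_apply x).add (continuous_apply y))
  · exact isClosed_iInter fun c => isClosed_iInter fun x =>
      isClosed_eq (continuous_apply _) (continuous_const.mul (continuous_apply x))
  · exact isClosed_iInter fun x => isClosed_le (continuous_apply x) continuous_const

theorem neg_le_distNonpos_neg {f : E → ℝ} (hf : f ∈ p.posDualBall) (x : E) :
    -f x ≤ p.distNonpos (-x) := by
  have h := hf.2.2 (-x)
  rwa [← neg_one_smul ℝ x, hf.2.1, neg_one_smul, neg_one_mul] at h

theorem abs_le_of_mem_posDualBall {f : E → ℝ} (hf : f ∈ p.posDualBall) (x : E) : |f x| ≤ p x := by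
  refine abs_le'.2 ⟨(hf.2.2 x).trans (p.distNonpos_le x), ?_⟩
  exact (p.neg_le_distNonpos_neg hf x).trans ((p.distNonpos_le _).trans_eq (map_neg_eq_map p x))

theorem nonneg_of_mem_posDualBall {f : E → ℝ} (hf : f ∈ p.posDualBall) {x : E} (hx : 0 ≤ x) :
    0 ≤ f x := by
  have h := (p.neg_le_distNonpos_neg hf x).trans (p.distNonpos_le_add (-x) hx)
  rw [neg_add_cancel, map_zero] at h
  linarith

theorem distNonpos_smul [PosSMulMono ℝ E] (c : ℝ) (hc : 0 < c) (x : E) :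
    p.distNonpos (c • x) = c * p.distNonpos x := by
  have key : ∀ (c : ℝ), 0 < c → ∀ x, p.distNonpos (c • x) ≤ c * p.distNonpos x := by
    intro c hc x
    rw [distNonpos, distNonpos, Real.mul_iInf_of_nonneg hc.le]
    have : Nonempty {y : E // 0 ≤ y} := ⟨⟨0, le_rfl⟩⟩
    refine le_ciInf fun y => ?_
    refine (p.distNonpos_le_add (c • x) (smul_nonneg hc.le y.2)).trans_eq ?_
    rw [← smul_add, map_smul_eq_mul, Real.norm_of_nonneg hc.le]
  refine (key c hc x).antisymm ?_
  have h := key c⁻¹ (inv_pos.2 hc) (c • x)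
  rwa [inv_smul_smul₀ hc.ne', le_inv_mul_iff₀ hc] at h

variable [IsOrderedAddMonoid E]

theorem distNonpos_add (x y : E) : p.distNonpos (x + y) ≤ p.distNonpos x + p.distNonpos y := by
  refine le_of_forall_pos_lt_add fun ε hε => ?_
  obtain ⟨a, ha, hxa⟩ := p.exists_add_lt_of_distNonpos_lt
    (lt_add_of_pos_right (p.distNonpos x) (half_pos hε))
  obtain ⟨b, hb, hyb⟩ := p.exists_add_lt_of_distNonpos_lt
    (lt_add_of_pos_right (p.distNonpos y) (half_pos hε))
  have h := (p.distNonpos_le_add (x + y) (add_nonneg ha hb)).trans_eq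
    (congrArg p (add_add_add_comm x y a b))
  linarith [map_add_le_add p (x + a) (y + b)]

theorem exists_mem_posDualBall_eq [PosSMulMono ℝ E] (x : E) :
    ∃ f ∈ p.posDualBall, f x = p.distNonpos x := by
  obtain ⟨g, hgx, hg⟩ :=
    exists_linearMap_le_sublinear_eq p.distNonpos p.distNonpos_smul p.distNonpos_add x
  exact ⟨g, ⟨map_add g, fun c y => by simp, hg⟩, hgx⟩

variable {p}

theorem IsIncreasing.distNonpos_eq (hp : p.IsIncreasing) {x : E} (hx : 0 ≤ x) :
    p.distNonpos x = p x := by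
  have : Nonempty {y : E // 0 ≤ y} := ⟨⟨0, le_rfl⟩⟩
  exact (p.distNonpos_le x).antisymm (le_ciInf fun y => hp hx (le_add_of_nonneg_right y.2))

/-- An increasing seminorm is dominated by a multiple of the gauge of the order-convex hull of its
unit ball: the cone is normal. -/
theorem IsIncreasing.le_distNonpos (hp : p.IsIncreasing) (x : E) :
    p x ≤ p.distNonpos x + 2 * p.distNonpos (-x) := by
  refine le_of_forall_pos_lt_add fun ε hε => ?_
  obtain ⟨a, ha, hxa⟩ := p.exists_add_lt_of_distNonpos_lt
    (lt_add_of_pos_right (p.distNonpos x) (by linarith : 0 < ε / 3))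
  obtain ⟨b, hb, hxb⟩ := p.exists_add_lt_of_distNonpos_lt
    (lt_add_of_pos_right (p.distNonpos (-x)) (by linarith : 0 < ε / 3))
  -- The term `x` cancels in the sum, leaving `a + b ≥ b ≥ 0`.
  have h₁ : p b ≤ p ((x + a) + (-x + b)) := hp hb (by
    rw [show (x + a) + (-x + b) = b + a by abel]
    exact le_add_of_nonneg_right ha)
  have h₂ := map_add_le_add p (x + a) (-x + b)
  have h₃ : p x ≤ p b + p (-x + b) := by
    have := map_sub_le_add p b (-x + b)
    rwa [show b - (-x + b) = x by abel] at this
  linarith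

end Seminorm

/-- Each `α` alone yields its own approximant `y ≥ 0` of `x`. A basic neighbourhood needs one `y`
for finitely many `α`, which the maximum seminorm `p β` supplies. -/
theorem IsSaturatedFamily.nonneg_of_distNonpos_neg_eq_zero {E A : Type*} [AddCommGroup E]
    [Module ℝ E] [TopologicalSpace E] [PartialOrder E] {p : A → Seminorm ℝ E}
    (hsat : IsSaturatedFamily p) (hp : IsCalibration p) (hcl : IsClosed {x : E | 0 ≤ x}) {x : E}
    (hx : ∀ α, (p α).distNonpos (-x) = 0) : 0 ≤ x := by
  refine hcl.closure_subset ((mem_closure_iff_nhds_basis hp.withSeminorms.hasBasis_ball).2 ?_)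
  rintro ⟨s, r⟩ hr
  rcases s.eq_empty_or_nonempty with rfl | hs
  · refine ⟨0, le_rfl, ?_⟩
    simpa [Seminorm.mem_ball, ← Seminorm.bot_eq_zero] using hr
  · obtain ⟨β, hβ⟩ := hsat s hs
    obtain ⟨y, hy, hyr⟩ := (p β).exists_add_lt_of_distNonpos_lt ((hx β).trans_lt hr)
    refine ⟨y, hy, ?_⟩
    rw [Seminorm.mem_ball]
    refine Seminorm.finset_sup_apply_lt hr fun α hα => ?_
    rw [hβ, neg_add_eq_sub] at hyr
    exact (Finset.le_sup' (fun α => p α (y - x)) hα).trans_lt hyr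

/-! ### The disjoint union of the dual balls, and evaluation on it. -/

section Representation

variable {E : Type u} {A : Type v} [AddCommGroup E] [Module ℝ E] [PartialOrder E]

/-- The disjoint union of the compact spaces `(p α).posDualBall`. -/
abbrev DualBallSum (p : A → Seminorm ℝ E) : Type (max u v w) :=
  ULift.{w} (Σ α, (p α).posDualBall)

variable (p : A → Seminorm ℝ E)

instance (α : A) : CompactSpace (p α).posDualBall :=
  isCompact_iff_compactSpace.1 (p α).isCompact_posDualBall

/-- The summand of `DualBallSum p` with index `α`. -/
def dualBallSummand (α : A) : Compacts (DualBallSum.{u, v, w} p) where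
  carrier := Set.range fun f : (p α).posDualBall => ULift.up ⟨α, f⟩
  isCompact' := isCompact_range (Homeomorph.ulift.symm.continuous.comp continuous_sigmaMk)

theorem mem_dualBallSummand {α : A} {t : DualBallSum.{u, v, w} p} :
    t ∈ dualBallSummand p α ↔ t.down.1 = α := by
  constructor
  · rintro ⟨f, rfl⟩
    rfl
  · rintro rfl
    exact ⟨t.down.2, rfl⟩

theorem isOpen_dualBallSummand (α : A) :
    IsOpen (dualBallSummand p α : Set (DualBallSum.{u, v, w} p)) := by
  have h := (isOpen_range_sigmaMk (σ := fun α => (p α).posDualBall) (i := α)).preimage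
    (continuous_uliftDown.{_, w})
  convert h using 1
  ext t
  rw [SetLike.mem_coe, mem_dualBallSummand]
  constructor
  · rintro rfl
    exact ⟨t.down.2, rfl⟩
  · rintro ⟨f, hf⟩
    exact congrArg Sigma.fst hf.symm

instance : WeaklyLocallyCompactSpace (DualBallSum.{u, v, w} p) where
  exists_compact_mem_nhds t := ⟨dualBallSummand p t.down.1, (dualBallSummand p _).isCompact,
    (isOpen_dualBallSummand p _).mem_nhds ((mem_dualBallSummand p).2 rfl)⟩

theorem exists_finset_subset_iUnion_dualBallSummand {L : Set (DualBallSum.{u, v, w} p)}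
    (hL : IsCompact L) : ∃ s : Finset A, L ⊆ ⋃ α ∈ s, (dualBallSummand p α : Set _) :=
  hL.elim_finite_subcover _ (isOpen_dualBallSummand p) fun t _ =>
    Set.mem_iUnion.2 ⟨t.down.1, (mem_dualBallSummand p).2 rfl⟩

theorem withSeminorms_dualBallSummand :
    WithSeminorms (fun α => supSeminorm (dualBallSummand.{u, v, w} p α)) :=
  withSeminorms_supSeminorm _ fun _ hL => exists_finset_subset_iUnion_dualBallSummand p hL

/-- Evaluation of functionals, as a map from `E` to the continuous functions on `DualBallSum p`. -/
def dualBallEval : E →ₗ[ℝ] C(DualBallSum.{u, v, w} p, ℝ) where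
  toFun x := ⟨fun t => t.down.2.1 x, by
    refine Continuous.comp (g := fun t : Σ α, (p α).posDualBall => t.2.1 x) ?_ continuous_uliftDown
    exact continuous_sigma fun α => (continuous_apply x).comp continuous_subtype_val⟩
  map_add' x y := by
    ext t
    exact t.down.2.2.1 x y
  map_smul' c x := by
    ext t
    exact t.down.2.2.2.1 c x

theorem dualBallEval_nonneg {x : E} (hx : 0 ≤ x) : 0 ≤ dualBallEval.{u, v, w} p x :=
  fun t => (p t.down.1).nonneg_of_mem_posDualBall t.down.2.2 hx

theorem supSeminorm_dualBallEval_le (α : A) (x : E) :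
    supSeminorm (dualBallSummand.{u, v, w} p α) (dualBallEval p x) ≤ p α x := by
  refine supSeminorm_le (apply_nonneg _ _) ?_
  rintro _ ⟨f, rfl⟩
  exact (p α).abs_le_of_mem_posDualBall f.2 x

theorem abs_le_supSeminorm_dualBallEval {α : A} {f : E → ℝ} (hf : f ∈ (p α).posDualBall) (x : E) :
    |f x| ≤ supSeminorm (dualBallSummand.{u, v, w} p α) (dualBallEval p x) :=
  abs_le_supSeminorm (dualBallSummand.{u, v, w} p α) (dualBallEval p x)
    (x := ULift.up ⟨α, ⟨f, hf⟩⟩) ((mem_dualBallSummand p).2 rfl)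

variable [IsOrderedAddMonoid E] [PosSMulMono ℝ E]

theorem distNonpos_le_supSeminorm_dualBallEval (α : A) (x : E) :
    (p α).distNonpos x ≤ supSeminorm (dualBallSummand.{u, v, w} p α) (dualBallEval p x) := by
  obtain ⟨f, hf, hfx⟩ := (p α).exists_mem_posDualBall_eq x
  exact hfx ▸ (le_abs_self _).trans (abs_le_supSeminorm_dualBallEval p hf x)

variable {p}

theorem Seminorm.IsIncreasing.supSeminorm_dualBallEval {α : A} (hα : (p α).IsIncreasing) {x : E}
    (hx : 0 ≤ x) : supSeminorm (dualBallSummand.{u, v, w} p α) (dualBallEval p x) = p α x :=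
  (supSeminorm_dualBallEval_le p α x).antisymm
    ((hα.distNonpos_eq hx).ge.trans (distNonpos_le_supSeminorm_dualBallEval p α x))

theorem Seminorm.IsIncreasing.le_supSeminorm_dualBallEval {α : A} (hα : (p α).IsIncreasing)
    (x : E) : p α x ≤ 3 * supSeminorm (dualBallSummand.{u, v, w} p α) (dualBallEval p x) := by
  have h₁ := distNonpos_le_supSeminorm_dualBallEval.{u, v, w} p α x
  have h₂ := distNonpos_le_supSeminorm_dualBallEval.{u, v, w} p α (-x)
  rw [map_neg, map_neg_eq_map] at h₂
  linarith [hα.le_distNonpos x]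

theorem IsCalibration.dualBallEval_injective [TopologicalSpace E] (hp : IsCalibration p)
    (hinc : ∀ α, (p α).IsIncreasing) : Function.Injective (dualBallEval.{u, v, w} p) := by
  refine (injective_iff_map_eq_zero _).2 fun x hx => hp.separating x fun α => ?_
  have h := (hinc α).le_supSeminorm_dualBallEval.{u, v, w} x
  rw [hx, map_zero, mul_zero] at h
  exact h.antisymm (apply_nonneg _ _)

theorem nonneg_of_dualBallEval_nonneg [TopologicalSpace E] (hp : IsCalibration p)
    (hsat : IsSaturatedFamily p) (hcl : IsClosed {x : E | 0 ≤ x}) {x : E}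
    (hx : 0 ≤ dualBallEval.{u, v, w} p x) : 0 ≤ x := by
  refine hsat.nonneg_of_distNonpos_neg_eq_zero hp hcl fun α => ?_
  -- At a functional attaining `distNonpos (-x)`, that value is `-f x ≤ 0`.
  obtain ⟨f, hf, hfx⟩ := (p α).exists_mem_posDualBall_eq (-x)
  refine le_antisymm ?_ ((p α).distNonpos_nonneg _)
  have h : 0 ≤ f x := hx (ULift.up ⟨α, ⟨f, hf⟩⟩)
  rw [← hfx, ← neg_one_smul ℝ x, hf.2.1]
  linarith

/-- The representation of `E` as a space of continuous functions on `DualBallSum p`. -/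
noncomputable def IsCalibration.dualBallEquiv [TopologicalSpace E] (hp : IsCalibration p)
    (hinc : ∀ α, (p α).IsIncreasing) : E ≃L[ℝ] LinearMap.range (dualBallEval.{u, v, w} p) :=
  have hW : WithSeminorms (SeminormFamily.comp (fun α => supSeminorm (dualBallSummand.{u, v, w} p α))
      (LinearMap.range (dualBallEval.{u, v, w} p)).subtype) :=
    IsInducing.subtypeVal.withSeminorms (withSeminorms_dualBallSummand p)
  let e := LinearEquiv.ofInjective _ (hp.dualBallEval_injective.{u, v, w} hinc)
  { e with
    continuous_toFun := by
      refine WithSeminorms.continuous_of_isBounded hp.withSeminorms hW e.toLinearMap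
        (Seminorm.IsBounded.of_real fun α => ⟨{α}, 1, fun x => ?_⟩)
      rw [Finset.sup_singleton, one_mul]
      exact supSeminorm_dualBallEval_le p α x
    continuous_invFun := by
      refine WithSeminorms.continuous_of_isBounded hW hp.withSeminorms e.symm.toLinearMap
        (Seminorm.IsBounded.of_real fun α => ⟨{α}, 3, fun g => ?_⟩)
      obtain ⟨x, rfl⟩ := e.surjective g
      rw [Finset.sup_singleton, LinearEquiv.coe_coe, e.symm_apply_apply]
      exact (hinc α).le_supSeminorm_dualBallEval x }

end Representation

theorem mainTheorem8 {E : Type u} {A : Type v}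
    [AddCommGroup E] [Module ℝ E] [TopologicalSpace E]
    [PartialOrder E] [IsOrderedAddMonoid E] [PosSMulMono ℝ E]
    (p : A → Seminorm ℝ E) (hp : IsCalibration p) (hsat : IsSaturatedFamily p) :
    (IsClosed {x : E | 0 ≤ x} ∧ ∀ α, (p α).IsIncreasing) ↔
      ∃ (X : Type (max u v w)) (_ : TopologicalSpace X) (_ : LocallyCompactSpace X)
        (_ : T2Space X) (W : Submodule ℝ C(X, ℝ)) (φ : E ≃L[ℝ] W)
        (K : A → TopologicalSpace.Compacts X),
        (∀ x : E, 0 ≤ x ↔ 0 ≤ (φ x : C(X, ℝ))) ∧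
        (Pairwise fun α β => Disjoint (K α : Set X) (K β : Set X)) ∧
        WithSeminorms (fun α => supSeminorm (K α)) ∧
        (⋃ α, (K α : Set X)) = Set.univ ∧
        (∀ L : Set X, IsCompact L → ∃ s : Finset A, L ⊆ ⋃ α ∈ s, (K α : Set X)) ∧
        ∀ α, ∀ x : E, 0 ≤ x → supSeminorm (K α) (φ x : C(X, ℝ)) = p α x := by
  constructor
  · rintro ⟨hcl, hinc⟩
    refine ⟨DualBallSum.{u, v, w} p, inferInstance, inferInstance, inferInstance, _,
      hp.dualBallEquiv.{u, v, w} hinc, dualBallSummand p, fun x => ⟨dualBallEval_nonneg p,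
        nonneg_of_dualBallEval_nonneg hp hsat hcl⟩, fun α β hαβ => ?_,
      withSeminorms_dualBallSummand p, ?_,
      fun L hL => exists_finset_subset_iUnion_dualBallSummand p hL,
      fun α x hx => (hinc α).supSeminorm_dualBallEval hx⟩
    · exact Set.disjoint_left.2 fun t hα hβ =>
        hαβ (((mem_dualBallSummand p).1 hα).symm.trans ((mem_dualBallSummand p).1 hβ))
    · exact Set.eq_univ_of_forall fun t =>
        Set.mem_iUnion.2 ⟨t.down.1, (mem_dualBallSummand p).2 rfl⟩
  · rintro ⟨X, _, _, _, W, φ, K, hφ, -, -, -, -, hK⟩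
    constructor
    · have h : {x : E | 0 ≤ x} = ⋂ t : X, {x : E | 0 ≤ (φ x : C(X, ℝ)) t} := by
        ext x
        simp only [Set.mem_ofPred_eq, Set.mem_iInter]
        exact hφ x
      rw [h]
      exact isClosed_iInter fun t => isClosed_le continuous_const
        ((ContinuousEvalConst.continuous_eval_const t).comp
          (continuous_subtype_val.comp φ.continuous))
    · intro α x y hy hyx
      rw [← hK α y hy, ← hK α x (hy.trans hyx)]
      refine supSeminorm_le (apply_nonneg _ _) fun t ht => ?_
      refine le_trans ?_ (abs_le_supSeminorm (K α) _ ht)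
      -- Bipositivity turns `0 ≤ y ≤ x` into a pointwise inequality at `t`.
      have h₀ : 0 ≤ (φ y : C(X, ℝ)) t := (hφ y).1 hy t
      have h₁ : 0 ≤ (φ (x - y) : C(X, ℝ)) t := (hφ (x - y)).1 (sub_nonneg.2 hyx) t
      rw [map_sub, Submodule.coe_sub, ContinuousMap.sub_apply] at h₁
      exact abs_le_abs_of_nonneg h₀ (sub_nonneg.1 h₁)
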